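/- Let $n$ be a natural number and let $\lambda=(\lambda_1\ge\dots\ge\lambda_n)$ be a dominant integral weight (a non-increasing sequence of integers, possibly with repetitions). For such a $\lambda$ let $GT_\lambda\subset\mathbb R^{\binom{n+1}{2}}$ be the Gelfand–Tsetlin polytope: in coordinates $A_{i,j}$, $0\le i\le n-1$, $1\le j\le n-i$, it is the set of points satisfying $A_{0,j}=\lambda_j$ for all $j$ and $A_{i,j}\ge A_{i+1,j}\ge A_{i,j+1}$ whenever these coordinates are defined. For a vertex $v$ of such a polytope $P$ let $C_v=\{v+t(x-v): x\in P,\ t\ge 0\}$ be the tangent cone at $v$, with apex $v$. Let $\lambda'=(\lambda'_1>\dots>\lambda'_n)$ be an arbitrary regular dominant integral weight. Every coordinate of a vertex $v'$ of $GT_{\lambda'}$ is equal to exactly one of the numbers $\lambda'_j$, and replacing, for all $j$, every coordinate of $v'$ equal to $\lambda'_j$ by $\lambda_j$ produces a vertex $\pi(v')$ of $GT_\lambda$. This defines a map $$\pi\colon\{\text{vertices of }GT_{\lambda'}\}\to\{\text{vertices of }GT_\lambda\}.$$ A rational polyhedron is an intersection of finitely many half-spaces of $\mathbb R^{\binom{n+1}{2}}$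 given by non-strict linear inequalities with integer coefficients (and integer constant terms). For a set $P$ let $[P]$ be its characteristic function. Let $\mathcal P$ be the real vector space of functions spanned by all $[P]$ with $P$ a rational polyhedron, and let $\mathcal Q\subset\mathcal P$ be the subspace spanned by those $[P]$ for which the rational polyhedron $P$ contains an affine line. For $X,Y\in\mathcal P$ write $X\approx Y$ if $X-Y\in\mathcal Q$. Then for every vertex $v$ of $GT_\lambda$ both sides of the following relation lie in $\mathcal P$, and $$[C_v]\approx\sum_{v'\in\pi^{-1}(v)}[C_{v'}+(v-v')].$$ -/

import Mathlib

/-- The nodes of a Gelfand-Tsetlin triangle of size `n`: pairs (row, column) of natural numbers with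
row + column < n. Rows and columns are both counted from 0, so the node usually denoted by (i, j)
with `0 ≤ i ≤ n - 1` and `1 ≤ j ≤ n - i` is the pair (i, j - 1). -/
abbrev GTNode (n : ℕ) : Type := {p : Fin n × Fin n // (p.1 : ℕ) + (p.2 : ℕ) < n}

namespace GTNode

/-- The row of a node. -/
def row {n : ℕ} (p : GTNode n) : ℕ := (p.1.1 : ℕ)

/-- The column of a node, as an element of `Fin n`. -/
def col {n : ℕ} (p : GTNode n) : Fin n := p.1.2

/-- `p.Dominates q` holds when `A p ≥ A q` is one of the Gelfand-Tsetlin inequalities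
`A (i, j) ≥ A (i + 1, j) ≥ A (i, j + 1)`. -/
def Dominates {n : ℕ} (p q : GTNode n) : Prop :=
  (q.row = p.row + 1 ∧ (q.col : ℕ) = p.col) ∨ (p.row = q.row + 1 ∧ (q.col : ℕ) = p.col + 1)

end GTNode

/-- The real space of dimension `n (n + 1) / 2` with coordinates labeled by the nodes. -/
abbrev GTSpace (n : ℕ) : Type := GTNode n → ℝ

/-- The Gelfand-Tsetlin polytope of the weight `wt`. -/
def GTPolytope {n : ℕ} (wt : Fin n → ℤ) : Set (GTSpace n) :=
  {x | (∀ p : GTNode n, p.row = 0 → x p = (wt p.col : ℝ)) ∧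
    ∀ p q : GTNode n, p.Dominates q → x q ≤ x p}

/-- The vertices of the Gelfand-Tsetlin polytope, i.e. its extreme points. -/
abbrev GTVertex {n : ℕ} (wt : Fin n → ℤ) : Type :=
  {v : GTSpace n // v ∈ (GTPolytope wt).extremePoints ℝ}

namespace GTVertex

/-- A direction which vanishes in row 0 and is constant along the edges that are tight at a vertex
is zero. -/
theorem direction_eq_zero {n : ℕ} {wt : Fin n → ℤ} (v : GTVertex wt) (d : GTSpace n)
    (h0 : ∀ p : GTNode n, p.row = 0 → d p = 0)
    (hd : ∀ p q : GTNode n, p.Dominates q → v.1 p = v.1 q → d p = d q) : d = 0 := by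
  obtain ⟨hvmem, hext⟩ := mem_extremePoints.1 v.2
  have hev : ∀ᶠ ε in nhds (0 : ℝ), ∀ p q : GTNode n, p.Dominates q →
      v.1 q + ε * d q ≤ v.1 p + ε * d p := by
    rw [Filter.eventually_all]
    intro p
    rw [Filter.eventually_all]
    intro q
    by_cases hpq : p.Dominates q
    · by_cases he : v.1 p = v.1 q
      · refine Filter.Eventually.of_forall fun ε _ => ?_
        rw [hd p q hpq he, he]
      · have hlt : v.1 q < v.1 p := lt_of_le_of_ne (hvmem.2 p q hpq) (Ne.symm he)
        have c1 : Filter.Tendsto (fun ε : ℝ => v.1 q + ε * d q) (nhds 0) (nhds (v.1 q)) :=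
          Continuous.tendsto' (by fun_prop) _ _ (by simp)
        have c2 : Filter.Tendsto (fun ε : ℝ => v.1 p + ε * d p) (nhds 0) (nhds (v.1 p)) :=
          Continuous.tendsto' (by fun_prop) _ _ (by simp)
        filter_upwards [c1.eventually_lt c2 hlt] with ε hε _
        exact hε.le
    · exact Filter.Eventually.of_forall fun ε h => absurd h hpq
  obtain ⟨δ, hδ, hball⟩ := Metric.eventually_nhds_iff.1 hev
  have hmem : ∀ ε : ℝ, |ε| < δ → v.1 + ε • d ∈ GTPolytope wt := by
    intro ε hε
    refine ⟨fun p hp => ?_, fun p q hpq => ?_⟩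
    · simp [hvmem.1 p hp, h0 p hp]
    · simpa using hball (y := ε) (by simpa [Real.dist_eq] using hε) p q hpq
  have hδ2 : |δ / 2| < δ := by rw [abs_of_pos (by linarith)]; linarith
  have hseg : v.1 ∈ openSegment ℝ (v.1 + (δ / 2) • d) (v.1 + (-(δ / 2)) • d) := by
    refine ⟨1 / 2, 1 / 2, by norm_num, by norm_num, by norm_num, ?_⟩
    ext p
    simp
    ring
  have h1 := (hext _ (hmem _ hδ2) _ (hmem _ (by rwa [abs_neg])) hseg).1
  ext p
  have h2 := congrFun h1 p
  simp only [Pi.add_apply, Pi.smul_apply, smul_eq_mul, add_eq_left, mul_eq_zero] at h2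
  rcases h2 with h2 | h2
  · linarith
  · exact h2

/-- Every coordinate of a vertex is one of the coordinates of the weight. -/
theorem exists_eq {n : ℕ} {wt : Fin n → ℤ} (v : GTVertex wt) (p : GTNode n) :
    ∃ j : Fin n, v.1 p = (wt j : ℝ) := by
  classical
  by_contra hne
  push Not at hne
  have h := v.direction_eq_zero (fun q => if v.1 q = v.1 p then 1 else 0)
    (fun q hq => if_neg fun he => hne q.col (by rw [← he]; exact v.2.1.1 q hq))
    (fun q r _ hqr => by simp [hqr])
  simpa using congrFun h p

theorem finite {n : ℕ} (wt : Fin n → ℤ) : Finite (GTVertex wt) := by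
  choose f hf using fun v : GTVertex wt => v.exists_eq
  refine Finite.of_injective f fun v w h => Subtype.ext (funext fun p => ?_)
  rw [hf, hf, h]

/-- The point obtained from a vertex `u` of the polytope of `reg` by replacing, for all `j`,
all the coordinates equal to `reg j` with `wt j` (see `substitute_eq`). -/
noncomputable def substitute {n : ℕ} (wt : Fin n → ℤ) {reg : Fin n → ℤ} (u : GTVertex reg) :
    GTSpace n :=
  fun p => (wt (u.exists_eq p).choose : ℝ)

theorem substitute_eq {n : ℕ} (wt : Fin n → ℤ) {reg : Fin n → ℤ} (hreg : StrictAnti reg)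
    (u : GTVertex reg) (p : GTNode n) (j : Fin n) (h : u.1 p = (reg j : ℝ)) :
    u.substitute wt p = (wt j : ℝ) := by
  have h' : reg j = reg (u.exists_eq p).choose := by
    exact_mod_cast h.symm.trans (u.exists_eq p).choose_spec
  have := hreg.injective h'
  simp only [substitute, ← this]

theorem substitute_mem {n : ℕ} {wt reg : Fin n → ℤ} (hwt : Antitone wt) (hreg : StrictAnti reg)
    (u : GTVertex reg) : u.substitute wt ∈ (GTPolytope wt).extremePoints ℝ := by
  have hmem : u.substitute wt ∈ GTPolytope wt := by
    refine ⟨fun p hp => u.substitute_eq wt hreg p _ (u.2.1.1 p hp), fun p q hpq => ?_⟩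
    obtain ⟨j, hj⟩ := u.exists_eq p
    obtain ⟨k, hk⟩ := u.exists_eq q
    rw [u.substitute_eq wt hreg p j hj, u.substitute_eq wt hreg q k hk]
    have h := u.2.1.2 p q hpq
    rw [hj, hk, Int.cast_le, hreg.le_iff_ge] at h
    exact_mod_cast hwt h
  rw [mem_extremePoints]
  refine ⟨hmem, fun y hy z hz hseg => ?_⟩
  obtain ⟨a, b, ha, hb, hab, hs⟩ := hseg
  have key : ∀ p : GTNode n, a * y p + b * z p = u.substitute wt p := fun p => by
    simpa using congrFun hs p
  have hyz : y - z = 0 := by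
    refine u.direction_eq_zero (y - z) (fun p hp => ?_) (fun p q hpq he => ?_)
    · simp [hy.1 p hp, hz.1 p hp]
    · obtain ⟨j, hj⟩ := u.exists_eq p
      have e : u.substitute wt p = u.substitute wt q := by
        rw [u.substitute_eq wt hreg p j hj, u.substitute_eq wt hreg q j (he ▸ hj)]
      have h1 := hy.2 p q hpq
      have h2 := hz.2 p q hpq
      have h3 : a * (y p - y q) + b * (z p - z q) = 0 := by
        linarith [key p, key q]
      have h4 : 0 ≤ a * (y p - y q) := mul_nonneg ha.le (by linarith)
      have h5 : 0 ≤ b * (z p - z q) := mul_nonneg hb.le (by linarith)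
      have h6 : a * (y p - y q) = 0 := by linarith
      have h7 : b * (z p - z q) = 0 := by linarith
      have h8 := (mul_eq_zero.1 h6).resolve_left ha.ne'
      have h9 := (mul_eq_zero.1 h7).resolve_left hb.ne'
      simp only [Pi.sub_apply]
      linarith
  have hyz' : y = z := sub_eq_zero.1 hyz
  subst hyz'
  have : y = u.substitute wt := by rw [← hs, ← add_smul, hab, one_smul]
  exact ⟨this, this⟩

end GTVertex

/-- The map `π` from the vertices of the polytope of a regular dominant weight `reg` to the vertices
of the polytope of a dominant weight `wt`: for all `j`, all the coordinates equal to `reg j` are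
replaced with `wt j`. -/
noncomputable def GTVertex.degenerate {n : ℕ} {wt reg : Fin n → ℤ} (hwt : Antitone wt)
    (hreg : StrictAnti reg) (u : GTVertex reg) : GTVertex wt :=
  ⟨u.substitute wt, u.substitute_mem hwt hreg⟩

/-- The (finite) fiber of the map `π` over a vertex `v`. -/
noncomputable def GTVertex.fiber {n : ℕ} {wt reg : Fin n → ℤ} (hwt : Antitone wt)
    (hreg : StrictAnti reg) (v : GTVertex wt) : Finset (GTVertex reg) :=
  haveI := GTVertex.finite reg
  (Set.toFinite {u : GTVertex reg | u.degenerate hwt hreg = v}).toFinset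

theorem GTVertex.mem_fiber {n : ℕ} {wt reg : Fin n → ℤ} (hwt : Antitone wt)
    (hreg : StrictAnti reg) (v : GTVertex wt) (u : GTVertex reg) :
    u ∈ v.fiber hwt hreg ↔ u.degenerate hwt hreg = v := by
  simp [GTVertex.fiber]

/-- The tangent cone of a convex set `P` at its point `v`, with its apex at `v`: the union of the
rays that start at `v` and pass through the points of `P`. -/
def convexTangentCone {ι : Type*} (P : Set (ι → ℝ)) (v : ι → ℝ) : Set (ι → ℝ) :=
  {y | ∃ x ∈ P, ∃ t : ℝ, 0 ≤ t ∧ y = v + t • (x - v)}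

/-- The tangent cone `C_v` of the Gelfand-Tsetlin polytope at its vertex `v`. -/
def GTVertex.cone {n : ℕ} {wt : Fin n → ℤ} (v : GTVertex wt) : Set (GTSpace n) :=
  convexTangentCone (GTPolytope wt) v.1

/-- Closed convex rational polyhedra: intersections of finitely many half-spaces given by non-strict
linear inequalities with integer coefficients. -/
def IsRationalPolyhedron {ι : Type*} [Fintype ι] (P : Set (ι → ℝ)) : Prop :=
  ∃ s : Finset ((ι → ℤ) × ℤ), P = {x | ∀ c ∈ s, ∑ i, (c.1 i : ℝ) * x i ≤ (c.2 : ℝ)}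

/-- The set `P` contains an affine line. -/
def ContainsAffineLine {ι : Type*} (P : Set (ι → ℝ)) : Prop :=
  ∃ a d : ι → ℝ, d ≠ 0 ∧ ∀ t : ℝ, a + t • d ∈ P

/-- The characteristic function `[P]` of `P`. -/
noncomputable def charFunction {ι : Type*} (P : Set (ι → ℝ)) : (ι → ℝ) → ℝ :=
  P.indicator (fun _ => (1 : ℝ))

/-- The real vector space spanned by the characteristic functions of rational polyhedra. -/
noncomputable def polyhedralSpan (ι : Type*) [Fintype ι] : Submodule ℝ ((ι → ℝ) → ℝ) :=
  Submodule.span ℝ {f | ∃ P : Set (ι → ℝ), IsRationalPolyhedron P ∧ f = charFunction P}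

/-- The subspace spanned by the characteristic functions of rational polyhedra that contain an
affine line. -/
noncomputable def lineSpan (ι : Type*) [Fintype ι] : Submodule ℝ ((ι → ℝ) → ℝ) :=
  Submodule.span ℝ
    {f | ∃ P : Set (ι → ℝ), IsRationalPolyhedron P ∧ ContainsAffineLine P ∧ f = charFunction P}

/-- `X ≈ Y` for elements `X` and `Y` of `polyhedralSpan ι`: their difference is in `lineSpan ι`. -/
def EqModLines {ι : Type*} [Fintype ι] (X Y : (ι → ℝ) → ℝ) : Prop :=
  X ∈ polyhedralSpan ι ∧ Y ∈ polyhedralSpan ι ∧ X - Y ∈ lineSpan ι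

/-!
Near a vertex `v` of the Gelfand-Tsetlin polytope of `wt`, the polytope of the regular weight `reg`
looks like the polyhedron `Q` that is given by row 0 of `reg` and by those Gelfand-Tsetlin
inequalities that are tight at `v`. The recession cone of `Q` is the tangent cone at `v`, moved to
the origin (`GTVertex.systemCone_self`). The points of `Q` whose tangent cone contains no line are
precisely the vertices in the fiber over `v`, and there the tangent cones of `Q` and of the polytope
of `reg` coincide (`GTVertex.exists_degenerate_eq`, `GTVertex.systemCone_of_degenerate_eq`). So the
theorem is an instance of a general fact, `coneRelation_of_nonempty`: for any nonempty polyhedron,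
the recession cone is, modulo cones with lines, the sum of the tangent cones at the vertices, all
with their apexes at the origin.

The general fact is proved by induction on the number of inequalities. If a hyperplane
`a k = b k` meets the polyhedron `P` given by all the other constraints, then both sides of the
relation are additive for the cut of `P` into `P ∩ {a k ≥ b k}` and `P ∩ {a k ≤ b k}`, up to the
contribution of `P ∩ {a k = b k}`; the relation for `P` and for the last polyhedron is known by
induction, so the relation for one half follows from the relation for the other
(`coneRelation_of_flip`). If the hyperplane does not meet `P`, the inequality `k` is implied by the
others and can be dropped (`coneRelation_insert_of_implied`). Hence inequalities may be reversed at
will. If all the constraints can be made tight at one point, the polyhedron is a translate of its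
recession cone, and the relation is clear (`coneRelation_of_tight`). Otherwise some combination
`∑ γ k * a k` vanishes while `∑ γ k * b k > 0`, and after reversals only one coefficient `γ j` of an
inequality is negative; then the inequality `j` is implied by the others.
-/

/-! ### Polyhedra and cones given by integral linear forms -/

open Filter

section LinearSystem

variable {ι κ : Type*}

/-- Translation of functions that carries the origin to the lattice point `w`. -/
noncomputable def latticeShift (w : ι → ℤ) : ((ι → ℝ) → ℝ) →ₗ[ℝ] ((ι → ℝ) → ℝ) :=
  LinearMap.funLeft ℝ ℝ fun y i => y i - (w i : ℝ)

theorem latticeShift_charFunction (w : ι → ℤ) (P : Set (ι → ℝ)) :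
    latticeShift w (charFunction P) = charFunction {y | (fun i => y i - (w i : ℝ)) ∈ P} := by
  classical
  ext y
  simp only [latticeShift, LinearMap.funLeft_apply, charFunction, Set.indicator_apply,
    Set.mem_ofPred_eq]

theorem charFunction_empty : charFunction (∅ : Set (ι → ℝ)) = 0 := by
  simp [charFunction, Pi.zero_def]

variable [Fintype ι]

/-- The linear form on `ι → ℝ` with the integer coefficients `c`. -/
noncomputable def intForm (c : ι → ℤ) : (ι → ℝ) →ₗ[ℝ] ℝ :=
  ∑ i, (c i : ℝ) • LinearMap.proj i

theorem intForm_apply (c : ι → ℤ) (x : ι → ℝ) : intForm c x = ∑ i, (c i : ℝ) * x i := by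
  simp [intForm]

@[simp]
theorem intForm_neg (c : ι → ℤ) : intForm (-c) = -intForm c := by
  ext x
  simp [intForm]

/-- The polyhedron given by the equations `a k = b k` for `k ∈ E` and the inequalities `a k ≥ b k`
for `k ∈ T`. -/
def systemSet (a : κ → ι → ℤ) (b : κ → ℝ) (E T : Finset κ) : Set (ι → ℝ) :=
  {x | (∀ k ∈ E, intForm (a k) x = b k) ∧ ∀ k ∈ T, b k ≤ intForm (a k) x}

/-- The cone of feasible directions of `systemSet a b E T` at `u`, with its apex at the origin:
only the inequalities that are tight at `u` are kept, and they are made homogeneous. It is empty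
when `u` is not a point of the polyhedron. -/
def systemCone (a : κ → ι → ℤ) (b : κ → ℝ) (E T : Finset κ) (u : ι → ℝ) : Set (ι → ℝ) :=
  {d | u ∈ systemSet a b E T ∧ (∀ k ∈ E, intForm (a k) d = 0) ∧
    ∀ k ∈ T, intForm (a k) u = b k → 0 ≤ intForm (a k) d}

theorem mem_systemCone {a : κ → ι → ℤ} {b : κ → ℝ} {E T : Finset κ}
    {u d : ι → ℝ} : d ∈ systemCone a b E T u ↔
      u ∈ systemSet a b E T ∧ (∀ k ∈ E, intForm (a k) d = 0) ∧
        ∀ k ∈ T, intForm (a k) u = b k → 0 ≤ intForm (a k) d := Iff.rfl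

theorem mem_systemCone_iff_exists {a : κ → ι → ℤ} {b : κ → ℝ} {E T : Finset κ} {u d : ι → ℝ} :
    d ∈ systemCone a b E T u ↔
      u ∈ systemSet a b E T ∧ ∃ ε : ℝ, 0 < ε ∧ u + ε • d ∈ systemSet a b E T := by
  constructor
  · rintro ⟨hu, hE, hT⟩
    refine ⟨hu, ?_⟩
    have hev : ∀ᶠ ε : ℝ in nhdsWithin 0 (Set.Ioi 0), ∀ k ∈ T,
        b k ≤ intForm (a k) u + ε * intForm (a k) d := by
      rw [Filter.eventually_all_finset]
      intro k hk
      rcases (hu.2 k hk).eq_or_lt with he | hlt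
      · filter_upwards [self_mem_nhdsWithin] with ε hε
        have := mul_nonneg (Set.mem_Ioi.1 hε).le (hT k hk he.symm)
        linarith
      · have c : Tendsto (fun ε : ℝ => intForm (a k) u + ε * intForm (a k) d) (nhds 0)
            (nhds (intForm (a k) u)) := Continuous.tendsto' (by fun_prop) _ _ (by simp)
        exact nhdsWithin_le_nhds ((c.eventually_const_lt hlt).mono fun ε hε => hε.le)
    obtain ⟨ε, hε, hpos⟩ := (hev.and self_mem_nhdsWithin).exists
    refine ⟨ε, hpos, fun k hk => ?_, fun k hk => ?_⟩
    · simp [hu.1 k hk, hE k hk]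
    · simpa using hε k hk
  · rintro ⟨hu, ε, hε, h⟩
    refine ⟨hu, fun k hk => ?_, fun k hk he => ?_⟩
    · have := h.1 k hk
      simp only [map_add, map_smul, smul_eq_mul, hu.1 k hk, add_eq_left, mul_eq_zero] at this
      exact this.resolve_left hε.ne'
    · have := h.2 k hk
      simp only [map_add, map_smul, smul_eq_mul, he, le_add_iff_nonneg_right] at this
      exact nonneg_of_mul_nonneg_right this hε

/-- The functions that become combinations of characteristic functions of polyhedra with lines
after the translation by `w`. -/
noncomputable def shiftedLineSpan (w : ι → ℤ) : Submodule ℝ ((ι → ℝ) → ℝ) :=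
  (lineSpan ι).comap (latticeShift w)

theorem isRationalPolyhedron_shift (w : ι → ℤ) (a : κ → ι → ℤ) (E T : Finset κ) :
    IsRationalPolyhedron {y : ι → ℝ | (fun i => y i - (w i : ℝ)) ∈ systemSet a 0 E T} := by
  classical
  let f : (ι → ℤ) → (ι → ℤ) × ℤ := fun c => (c, ∑ i, c i * w i)
  have hf : ∀ (c : ι → ℤ) (y : ι → ℝ),
      ∑ i, ((f c).1 i : ℝ) * y i ≤ ((f c).2 : ℝ) ↔
        intForm c (fun i => y i - (w i : ℝ)) ≤ 0 := by
    intro c y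
    simp [f, intForm_apply, mul_sub, Finset.sum_sub_distrib]
  refine ⟨((E ∪ T).image fun k => f (-a k)) ∪ E.image fun k => f (a k), ?_⟩
  ext y
  simp only [Set.mem_ofPred_eq, systemSet, Finset.mem_union, Finset.mem_image]
  constructor
  · rintro ⟨hE, hT⟩ c (⟨k, hk | hk, rfl⟩ | ⟨k, hk, rfl⟩)
    · rw [hf]; simp [hE k hk]
    · rw [hf]; simpa using hT k hk
    · rw [hf]; simp [hE k hk]
  · intro h
    refine ⟨fun k hk => le_antisymm ?_ ?_, fun k hk => ?_⟩
    · exact (hf _ _).1 (h _ (Or.inr ⟨k, hk, rfl⟩))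
    · have := (hf _ _).1 (h _ (Or.inl ⟨k, Or.inl hk, rfl⟩))
      simpa using this
    · have := (hf _ _).1 (h _ (Or.inl ⟨k, Or.inr hk, rfl⟩))
      simpa using this

theorem latticeShift_mem_polyhedralSpan (w : ι → ℤ) (a : κ → ι → ℤ) (E T : Finset κ) :
    latticeShift w (charFunction (systemSet a 0 E T)) ∈ polyhedralSpan ι :=
  Submodule.subset_span
    ⟨_, isRationalPolyhedron_shift w a E T, latticeShift_charFunction w _⟩

theorem charFunction_mem_shiftedLineSpan (w : ι → ℤ) (a : κ → ι → ℤ) (E T : Finset κ)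
    (d : ι → ℝ) (hd : d ≠ 0) (hE : ∀ k ∈ E, intForm (a k) d = 0)
    (hT : ∀ k ∈ T, intForm (a k) d = 0) :
    charFunction (systemSet a 0 E T) ∈ shiftedLineSpan w := by
  refine Submodule.subset_span
    ⟨_, isRationalPolyhedron_shift w a E T, ?_, latticeShift_charFunction w _⟩
  refine ⟨fun i => (w i : ℝ), d, hd, fun t => ?_⟩
  have h : (fun i => ((fun i => (w i : ℝ)) + t • d) i - (w i : ℝ)) = t • d := by
    ext i
    simp
  rw [Set.mem_ofPred_eq, h]
  exact ⟨fun k hk => by simp [hE k hk], fun k hk => by simp [hT k hk]⟩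

open scoped Classical in
theorem systemCone_eq_systemSet {a : κ → ι → ℤ} {b : κ → ℝ} {E T : Finset κ} {u : ι → ℝ}
    (hu : u ∈ systemSet a b E T) :
    systemCone a b E T u = systemSet a 0 E {k ∈ T | intForm (a k) u = b k} := by
  ext d
  simp only [mem_systemCone, hu, true_and]
  simp [systemSet]

theorem systemCone_eq_empty {a : κ → ι → ℤ} {b : κ → ℝ} {E T : Finset κ} {u : ι → ℝ}
    (hu : u ∉ systemSet a b E T) : systemCone a b E T u = ∅ := by
  ext d
  simp [mem_systemCone, hu]

/-- A point at which some nonzero direction preserves the equations and all the tight inequalities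
contributes zero modulo lines. -/
theorem charFunction_systemCone_mem (w : ι → ℤ) {a : κ → ι → ℤ} {b : κ → ℝ} {E T : Finset κ}
    {u : ι → ℝ} (h : u ∈ systemSet a b E T → ∃ d : ι → ℝ, d ≠ 0 ∧
      (∀ k ∈ E, intForm (a k) d = 0) ∧
      ∀ k ∈ T, intForm (a k) u = b k → intForm (a k) d = 0) :
    charFunction (systemCone a b E T u) ∈ shiftedLineSpan w := by
  classical
  by_cases hu : u ∈ systemSet a b E T
  · obtain ⟨d, hd, hE, hT⟩ := h hu
    rw [systemCone_eq_systemSet hu]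
    exact charFunction_mem_shiftedLineSpan w a E _ d hd hE fun k hk => by
      rw [Finset.mem_filter] at hk
      exact hT k hk.1 hk.2
  · rw [systemCone_eq_empty hu, charFunction_empty]
    exact Submodule.zero_mem _

/-! ### Recession cones and tangent cones -/

/-- Modulo functions of polyhedra with lines, the recession cone of the polyhedron is the sum of the
tangent cones at its points, all moved to the origin. All but finitely many points contribute zero
modulo lines, so the sum is taken over all sufficiently large finite sets of points, which avoids
any mention of vertices. -/
def ConeRelation (w : ι → ℤ) (a : κ → ι → ℤ) (b : κ → ℝ) (E T : Finset κ) : Prop :=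
  ∀ᶠ F : Finset (ι → ℝ) in atTop,
    charFunction (systemSet a 0 E T) - ∑ u ∈ F, charFunction (systemCone a b E T u) ∈
      shiftedLineSpan w

/-- The relation for a translate of a cone: its apex contributes the whole cone, and at any other
point `u` the line through `u` and the apex is tangent. -/
theorem coneRelation_of_tight (w : ι → ℤ) {a : κ → ι → ℤ} {b : κ → ℝ} {E T : Finset κ}
    {x : ι → ℝ} (hE : ∀ k ∈ E, intForm (a k) x = b k) (hT : ∀ k ∈ T, intForm (a k) x = b k) :
    ConeRelation w a b E T := by
  classical
  filter_upwards [eventually_ge_atTop {x}] with F hF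
  have hxF : x ∈ F := by simpa using hF
  have hx : systemCone a b E T x = systemSet a 0 E T := by
    rw [systemCone_eq_systemSet ⟨hE, fun k hk => (hT k hk).ge⟩, Finset.filter_true_of_mem hT]
  rw [← Finset.add_sum_erase F _ hxF, hx, sub_add_cancel_left]
  refine Submodule.neg_mem _ (Submodule.sum_mem _ fun u hu => ?_)
  refine charFunction_systemCone_mem w fun hmem => ⟨u - x, ?_, fun k hk => ?_, fun k hk he => ?_⟩
  · exact sub_ne_zero.2 (Finset.ne_of_mem_erase hu)
  · simp [hmem.1 k hk, hE k hk]
  · simp [he, hT k hk]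

/-- An implied inequality can be dropped. -/
theorem coneRelation_insert_of_implied [DecidableEq κ] {w : ι → ℤ} {a : κ → ι → ℤ} {b : κ → ℝ}
    {E T : Finset κ} {k : κ} (hne : (systemSet a b E T).Nonempty)
    (hk : ∀ x ∈ systemSet a b E T, b k ≤ intForm (a k) x) (h : ConeRelation w a b E T) :
    ConeRelation w a b E (insert k T) := by
  have hset : systemSet a b E (insert k T) = systemSet a b E T := by
    ext x
    simp only [systemSet, Finset.forall_mem_insert, Set.mem_ofPred_eq]
    exact ⟨fun h => ⟨h.1, h.2.2⟩, fun h => ⟨h.1, hk x h, h.2⟩⟩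
  have hcone : ∀ u, systemCone a b E (insert k T) u = systemCone a b E T u := by
    intro u
    ext d
    simp only [mem_systemCone_iff_exists, hset]
  have hrec : systemSet a 0 E (insert k T) = systemSet a 0 E T := by
    ext d
    simp only [systemSet, Finset.forall_mem_insert, Set.mem_ofPred_eq]
    refine ⟨fun h => ⟨h.1, h.2.2⟩, fun h => ⟨h.1, ?_, h.2⟩⟩
    obtain ⟨x, hx⟩ := hne
    -- The inequality holds on the whole ray from `x` in the direction `d`.
    by_contra! hlt
    simp only [Pi.zero_apply] at hlt
    have h1 : ∀ t : ℝ, 0 ≤ t → b k ≤ intForm (a k) x + t * intForm (a k) d := by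
      intro t ht
      have := hk (x + t • d) ⟨fun e he => ?_, fun e he => ?_⟩
      · simpa using this
      · simp [hx.1 e he, h.1 e he]
      · have := mul_nonneg ht (h.2 e he)
        simp only [map_add, map_smul, smul_eq_mul]
        linarith [hx.2 e he]
    have h2 := hk x hx
    have h3 := h1 ((intForm (a k) x - b k + 1) / -intForm (a k) d)
      (div_nonneg (by linarith) (by linarith))
    rw [div_mul_eq_mul_div, div_neg, mul_div_cancel_right₀ _ hlt.ne] at h3
    linarith
  simpa only [ConeRelation, hcone, hrec] using h

/-! ### Reversal of constraints -/

/-- The reversal of the constraint `k`: both sides change their sign. -/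
def flipForm [DecidableEq κ] (a : κ → ι → ℤ) (k : κ) : κ → ι → ℤ := Function.update a k (-a k)

/-- The right-hand sides of the system with the constraint `k` reversed. The coefficients of a linear
dependency of the constraints change in the same way. -/
def flipBound [DecidableEq κ] (b : κ → ℝ) (k : κ) : κ → ℝ := Function.update b k (-b k)

theorem flipBound_zero [DecidableEq κ] (k : κ) : flipBound (0 : κ → ℝ) k = 0 := by
  simp [flipBound]

theorem intForm_flipForm_eq_iff [DecidableEq κ] (a : κ → ι → ℤ) (b : κ → ℝ) (k e : κ) (x : ι → ℝ) :
    intForm (flipForm a k e) x = flipBound b k e ↔ intForm (a e) x = b e := by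
  by_cases h : e = k
  · subst h; simp [flipForm, flipBound]
  · simp [flipForm, flipBound, h]

theorem flipBound_le_iff_of_ne [DecidableEq κ] (a : κ → ι → ℤ) (b : κ → ℝ) {k e : κ} (h : e ≠ k)
    (x : ι → ℝ) :
    flipBound b k e ≤ intForm (flipForm a k e) x ↔ b e ≤ intForm (a e) x := by
  simp [flipForm, flipBound, h]

theorem mem_systemSet_insert [DecidableEq κ] {a : κ → ι → ℤ} {b : κ → ℝ} {E T : Finset κ} {k : κ}
    {x : ι → ℝ} : x ∈ systemSet a b E (insert k T) ↔
      x ∈ systemSet a b E T ∧ b k ≤ intForm (a k) x := by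
  simp only [systemSet, Finset.forall_mem_insert, Set.mem_ofPred_eq]
  tauto

theorem mem_systemSet_insert_eq [DecidableEq κ] {a : κ → ι → ℤ} {b : κ → ℝ} {E T : Finset κ}
    {k : κ} {x : ι → ℝ} : x ∈ systemSet a b (insert k E) T ↔
      x ∈ systemSet a b E T ∧ intForm (a k) x = b k := by
  simp only [systemSet, Finset.forall_mem_insert, Set.mem_ofPred_eq]
  tauto

theorem mem_systemSet_flip [DecidableEq κ] {a : κ → ι → ℤ} {b : κ → ℝ} {E T : Finset κ} {k : κ}
    (hk : k ∉ T) {x : ι → ℝ} :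
    x ∈ systemSet (flipForm a k) (flipBound b k) E (insert k T) ↔
      x ∈ systemSet a b E T ∧ intForm (a k) x ≤ b k := by
  rw [mem_systemSet_insert]
  refine and_congr ?_ (by simp [flipForm, flipBound])
  simp only [systemSet, Set.mem_ofPred_eq, intForm_flipForm_eq_iff]
  refine and_congr Iff.rfl (forall₂_congr fun e he => ?_)
  exact flipBound_le_iff_of_ne a b (ne_of_mem_of_not_mem he hk) x

/-- Cutting a polyhedron by the hyperplane `a k = b k`, for recession cones. -/
theorem charFunction_systemSet_cut [DecidableEq κ] (a : κ → ι → ℤ) {E T : Finset κ} {k : κ}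
    (hk : k ∉ T) :
    charFunction (systemSet a 0 E (insert k T)) +
        charFunction (systemSet (flipForm a k) 0 E (insert k T)) =
      charFunction (systemSet a 0 E T) + charFunction (systemSet a 0 (insert k E) T) := by
  classical
  ext d
  have h := mem_systemSet_flip (a := a) (b := 0) (E := E) hk (x := d)
  rw [flipBound_zero] at h
  simp only [charFunction, Pi.add_apply, Set.indicator_apply, h, mem_systemSet_insert,
    mem_systemSet_insert_eq, Pi.zero_apply]
  rcases lt_trichotomy (intForm (a k) d) 0 with h1 | h1 | h1
  · simp [h1.le, h1.ne, h1.not_ge]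
  · simp [h1]
  · simp [h1.le, h1.ne', h1.not_ge]

/-- Cutting a polyhedron by the hyperplane `a k = b k`, for tangent cones. -/
theorem charFunction_systemCone_cut [DecidableEq κ] (a : κ → ι → ℤ) (b : κ → ℝ)
    {E T : Finset κ} {k : κ} (hk : k ∉ T) (u : ι → ℝ) :
    charFunction (systemCone a b E (insert k T) u) +
        charFunction (systemCone (flipForm a k) (flipBound b k) E (insert k T) u) =
      charFunction (systemCone a b E T u) + charFunction (systemCone a b (insert k E) T u) := by
  classical
  ext d
  have h0 : d ∈ systemCone a b E (insert k T) u ↔ d ∈ systemCone a b E T u ∧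
      b k ≤ intForm (a k) u ∧ (intForm (a k) u = b k → 0 ≤ intForm (a k) d) := by
    simp only [mem_systemCone, mem_systemSet_insert, Finset.forall_mem_insert]
    tauto
  have h1 : d ∈ systemCone (flipForm a k) (flipBound b k) E (insert k T) u ↔
      d ∈ systemCone a b E T u ∧
        intForm (a k) u ≤ b k ∧ (intForm (a k) u = b k → intForm (a k) d ≤ 0) := by
    have hE : (∀ e ∈ E, intForm (flipForm a k e) d = 0) ↔ ∀ e ∈ E, intForm (a e) d = 0 := by
      refine forall₂_congr fun e _ => ?_
      simpa [flipBound_zero] using intForm_flipForm_eq_iff a 0 k e d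
    have hT : (∀ e ∈ T, intForm (a e) u = b e → 0 ≤ intForm (flipForm a k e) d) ↔
        ∀ e ∈ T, intForm (a e) u = b e → 0 ≤ intForm (a e) d := by
      refine forall₂_congr fun e he => ?_
      have hek : e ≠ k := ne_of_mem_of_not_mem he hk
      simp [flipForm, hek]
    have hkk : 0 ≤ intForm (flipForm a k k) d ↔ intForm (a k) d ≤ 0 := by simp [flipForm]
    simp only [mem_systemCone, mem_systemSet_flip hk, Finset.forall_mem_insert,
      hE, hkk]
    constructor
    · rintro ⟨⟨hu, huk⟩, hdE, hdk, hdT⟩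
      exact ⟨⟨hu, hdE, hT.1 fun e he h => hdT e he ((intForm_flipForm_eq_iff a b k e u).2 h)⟩,
        huk, fun h => hdk ((intForm_flipForm_eq_iff a b k k u).2 h)⟩
    · rintro ⟨⟨hu, hdE, hdT⟩, huk, hdk⟩
      exact ⟨⟨hu, huk⟩, hdE, fun h => hdk ((intForm_flipForm_eq_iff a b k k u).1 h),
        fun e he h => hT.2 hdT e he ((intForm_flipForm_eq_iff a b k e u).1 h)⟩
  have h2 : d ∈ systemCone a b (insert k E) T u ↔ d ∈ systemCone a b E T u ∧
      intForm (a k) u = b k ∧ intForm (a k) d = 0 := by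
    simp only [mem_systemCone, mem_systemSet_insert_eq, Finset.forall_mem_insert]
    tauto
  simp only [charFunction, Pi.add_apply, Set.indicator_apply, h0, h1, h2]
  rcases lt_trichotomy (intForm (a k) u) (b k) with hu | hu | hu
  · simp [hu.le, hu.ne, hu.not_ge]
  · rcases lt_trichotomy (intForm (a k) d) 0 with hd | hd | hd
    · simp [hu, hd.le, hd.ne, hd.not_ge]
    · simp [hu, hd]
    · simp [hu, hd.le, hd.ne', hd.not_ge]
  · simp [hu.le, hu.ne', hu.not_ge]

theorem coneRelation_insert_of_cut [DecidableEq κ] {w : ι → ℤ} {a : κ → ι → ℤ} {b : κ → ℝ}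
    {E T : Finset κ} {k : κ} (hk : k ∉ T) (h : ConeRelation w a b E T)
    (heq : ConeRelation w a b (insert k E) T)
    (hflip : ConeRelation w (flipForm a k) (flipBound b k) E (insert k T)) :
    ConeRelation w a b E (insert k T) := by
  filter_upwards [h, heq, hflip] with F h1 h2 h3
  have h4 := Submodule.sub_mem _ (Submodule.add_mem _ h1 h2) h3
  have hc := Finset.sum_congr (rfl : F = F) fun u _ =>
    charFunction_systemCone_cut a b (E := E) hk u
  rw [Finset.sum_add_distrib, Finset.sum_add_distrib] at hc
  convert h4 using 1
  rw [eq_sub_of_add_eq (charFunction_systemSet_cut a (E := E) hk), eq_sub_of_add_eq hc]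
  abel

/-- Given the relation for the systems with fewer inequalities, the relation for a system follows
from the relation for the system with the constraint `k` reversed. If the hyperplane `a k = b k` does
not meet the polyhedron of the other constraints, then `k` is implied by them and no reversal is
needed. -/
theorem coneRelation_of_flip [DecidableEq κ] {w : ι → ℤ} {a : κ → ι → ℤ} {b : κ → ℝ}
    {E T : Finset κ} {k : κ} (hk : k ∈ T) (hne : (systemSet a b E T).Nonempty)
    (ih : ∀ E' : Finset κ, (systemSet a b E' (T.erase k)).Nonempty →
      ConeRelation w a b E' (T.erase k))
    (hflip : (systemSet (flipForm a k) (flipBound b k) E T).Nonempty →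
      ConeRelation w (flipForm a k) (flipBound b k) E T) :
    ConeRelation w a b E T := by
  have hkT : k ∉ T.erase k := Finset.notMem_erase k T
  rw [← Finset.insert_erase hk] at hne hflip ⊢
  obtain ⟨x, hx⟩ := hne
  rw [mem_systemSet_insert] at hx
  by_cases hcut : (systemSet a b (insert k E) (T.erase k)).Nonempty
  · refine coneRelation_insert_of_cut hkT (ih E ⟨x, hx.1⟩) (ih _ hcut) (hflip ?_)
    obtain ⟨y, hy⟩ := hcut
    rw [mem_systemSet_insert_eq] at hy
    exact ⟨y, (mem_systemSet_flip hkT).2 ⟨hy.1, hy.2.le⟩⟩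
  · refine coneRelation_insert_of_implied ⟨x, hx.1⟩ (fun y hy => ?_) (ih E ⟨x, hx.1⟩)
    -- Otherwise the segment from `x` to `y` crosses the hyperplane inside the polyhedron.
    by_contra! hlt
    refine hcut ?_
    set s := intForm (a k) x
    set r := intForm (a k) y
    have hpos : 0 < s - r := by linarith [hx.2]
    have hα : 0 ≤ (b k - r) / (s - r) := div_nonneg (by linarith) hpos.le
    have hβ : 0 ≤ (s - b k) / (s - r) := div_nonneg (by linarith [hx.2]) hpos.le
    have hαβ : (b k - r) / (s - r) + (s - b k) / (s - r) = 1 := by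
      field_simp
      ring
    refine ⟨((b k - r) / (s - r)) • x + ((s - b k) / (s - r)) • y,
      mem_systemSet_insert_eq.2 ⟨⟨fun e he => ?_, fun e he => ?_⟩, ?_⟩⟩
    · simp only [map_add, map_smul, smul_eq_mul, hx.1.1 e he, hy.1 e he]
      rw [← add_mul, hαβ, one_mul]
    · simp only [map_add, map_smul, smul_eq_mul]
      calc b e = (b k - r) / (s - r) * b e + (s - b k) / (s - r) * b e := by
            rw [← add_mul, hαβ, one_mul]
        _ ≤ _ := add_le_add (mul_le_mul_of_nonneg_left (hx.1.2 e he) hα)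
            (mul_le_mul_of_nonneg_left (hy.2 e he) hβ)
    · simp only [map_add, map_smul, smul_eq_mul]
      change (b k - r) / (s - r) * s + (s - b k) / (s - r) * r = b k
      field_simp
      ring

/-! ### The relation for arbitrary polyhedra -/

/-- An inconsistent system of linear equations has a combination that reads `0 = c` with
`0 < c`. -/
theorem exists_certificate [DecidableEq κ] (a : κ → ι → ℤ) (b : κ → ℝ) (S : Finset κ)
    (h : ¬ ∃ x : ι → ℝ, ∀ k ∈ S, intForm (a k) x = b k) :
    ∃ γ : κ → ℝ, (∀ x : ι → ℝ, ∑ k ∈ S, γ k * intForm (a k) x = 0) ∧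
      0 < ∑ k ∈ S, γ k * b k := by
  let A : (ι → ℝ) →ₗ[ℝ] (S → ℝ) := LinearMap.pi fun k => intForm (a k)
  have hb : (fun k : S => b k) ∉ LinearMap.range A := by
    rintro ⟨x, hx⟩
    exact h ⟨x, fun k hk => congrFun hx ⟨k, hk⟩⟩
  obtain ⟨f, hf, hker⟩ := Submodule.exists_le_ker_of_notMem hb
  have hfsum : ∀ y : κ → ℝ, f (fun k : S => y k) =
      ∑ k ∈ S, (if h : k ∈ S then f (Pi.single ⟨k, h⟩ 1) else 0) * y k := by
    intro y
    rw [← Finset.sum_coe_sort S, LinearMap.pi_apply_eq_sum_univ f]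
    refine Finset.sum_congr rfl fun k _ => ?_
    simp only [smul_eq_mul, Finset.coe_mem, dite_true]
    rw [mul_comm]
    congr 2
    ext j
    simp [Pi.single_apply, eq_comm]
  set g : κ → ℝ := fun k => if h : k ∈ S then f (Pi.single ⟨k, h⟩ 1) else 0
  have h0 : ∀ x : ι → ℝ, ∑ k ∈ S, g k * intForm (a k) x = 0 := fun x => by
    rw [← hfsum fun k => intForm (a k) x]
    exact hker ⟨x, rfl⟩
  rw [hfsum b] at hf
  rcases lt_or_gt_of_ne hf with hneg | hpos
  · exact ⟨-g, fun x => by simp [h0 x], by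
      simpa only [Pi.neg_apply, neg_mul, Finset.sum_neg_distrib, neg_pos] using hneg⟩
  · exact ⟨g, h0, hpos⟩

/-- The relation between the recession cone and the tangent cones of a nonempty polyhedron.
Unless all the constraints can be made tight at once, there is a linear dependency of the
constraints with a positive right-hand side. Constraints are reversed one by one until just one
inequality has a negative coefficient in the dependency; that inequality is implied by the rest. -/
theorem coneRelation_of_nonempty [DecidableEq κ] (w : ι → ℤ) (T : Finset κ) :
    ∀ (E : Finset κ) (a : κ → ι → ℤ) (b : κ → ℝ), (systemSet a b E T).Nonempty →
      ConeRelation w a b E T := by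
  induction T using Finset.strongInduction with
  | H T ih =>
  intro E a b hne
  by_cases htight : ∃ x : ι → ℝ, ∀ k ∈ E ∪ T, intForm (a k) x = b k
  · obtain ⟨x, hx⟩ := htight
    exact coneRelation_of_tight w (fun k hk => hx k (Finset.mem_union_left _ hk))
      fun k hk => hx k (Finset.mem_union_right _ hk)
  obtain ⟨γ, hγ, hc⟩ := exists_certificate a b (E ∪ T) htight
  obtain ⟨j, hjT, hj⟩ : ∃ j ∈ T, γ j ≠ 0 := by
    by_contra! hzero
    obtain ⟨x, hx⟩ := hne
    refine hc.ne ?_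
    rw [← hγ x]
    refine Finset.sum_congr rfl fun k hk => ?_
    rcases Finset.mem_union.1 hk with hkE | hkT
    · rw [hx.1 k hkE]
    · rw [hzero k hkT, zero_mul, zero_mul]
  -- `S` contains the inequalities whose coefficient has yet to change its sign.
  suffices key : ∀ (S : Finset κ) (a : κ → ι → ℤ) (b γ : κ → ℝ), (systemSet a b E T).Nonempty →
      (∀ x : ι → ℝ, ∑ k ∈ E ∪ T, γ k * intForm (a k) x = 0) →
      0 < ∑ k ∈ E ∪ T, γ k * b k → γ j ≠ 0 →
      (∀ k ∈ T, k ∉ S → (k = j → γ k < 0) ∧ (k ≠ j → 0 ≤ γ k)) →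
      ConeRelation w a b E T from
    key T a b γ hne hγ hc hj fun k hk hkT => absurd hk hkT
  intro S
  induction S using Finset.induction_on with
  | empty =>
    intro a b γ hne hγ hc hj hsign
    rw [← Finset.insert_erase hjT] at hne ⊢
    obtain ⟨y, hy⟩ := hne
    have hne' : (systemSet a b E (T.erase j)).Nonempty := ⟨y, (mem_systemSet_insert.1 hy).1⟩
    refine coneRelation_insert_of_implied hne' (fun x hx => ?_)
      (ih _ (Finset.erase_ssubset hjT) E a b hne')
    by_contra! hlt
    have hnn : 0 ≤ ∑ k ∈ E ∪ T, γ k * (intForm (a k) x - b k) := by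
      refine Finset.sum_nonneg fun k hk => ?_
      by_cases hkE : k ∈ E
      · rw [hx.1 k hkE, sub_self, mul_zero]
      have hkT : k ∈ T := (Finset.mem_union.1 hk).resolve_left hkE
      obtain ⟨h1, h2⟩ := hsign k hkT (Finset.notMem_empty k)
      by_cases hkj : k = j
      · subst hkj
        exact mul_nonneg_of_nonpos_of_nonpos (h1 rfl).le (by linarith)
      · exact mul_nonneg (h2 hkj) (sub_nonneg.2 (hx.2 k (Finset.mem_erase.2 ⟨hkj, hkT⟩)))
    simp only [mul_sub, Finset.sum_sub_distrib, hγ x] at hnn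
    linarith
  | insert k S _ ihS =>
    intro a b γ hne hγ hc hj hsign
    by_cases hgood : k ∈ T → (k = j → γ k < 0) ∧ (k ≠ j → 0 ≤ γ k)
    · refine ihS a b γ hne hγ hc hj fun e he heS => ?_
      by_cases hek : e = k
      · subst hek
        exact hgood he
      · exact hsign e he (by simp [hek, heS])
    rw [Classical.not_imp] at hgood
    obtain ⟨hkT, hbad⟩ := hgood
    refine coneRelation_of_flip hkT hne
      (fun E' hE' => ih _ (Finset.erase_ssubset hkT) E' a b hE') fun hne' => ?_
    refine ihS (flipForm a k) (flipBound b k) (flipBound γ k) hne' (fun x => ?_) ?_ ?_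
      fun e he heS => ?_
    · rw [← hγ x]
      refine Finset.sum_congr rfl fun e _ => ?_
      by_cases hek : e = k
      · subst hek; simp [flipForm, flipBound]
      · simp [flipForm, flipBound, hek]
    · convert hc using 2 with e
      by_cases hek : e = k
      · subst hek; simp [flipBound]
      · simp [flipBound, hek]
    · by_cases hjk : j = k
      · subst hjk; simpa [flipBound] using hj
      · simpa [flipBound, hjk] using hj
    · by_cases hek : e = k
      · subst hek
        simp only [flipBound, Function.update_self]
        by_cases hej : e = j
        · subst hej
          simp only [forall_const, ne_eq, not_true_eq_false, IsEmpty.forall_iff, and_true,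
            not_lt] at hbad ⊢
          exact neg_lt_zero.2 (lt_of_le_of_ne hbad hj.symm)
        · simp only [hej, IsEmpty.forall_iff, ne_eq, not_false_eq_true, forall_const, true_and,
            not_le] at hbad ⊢
          linarith
      · simpa [flipBound, hek] using hsign e he (by simp [hek, heS])

end LinearSystem

/-! ### Gelfand-Tsetlin polytopes -/

section GelfandTsetlin

variable {n : ℕ}

/-- The linear forms in the definition of a Gelfand-Tsetlin polytope: the coordinates and the
differences of two coordinates. -/
def gtForm : GTNode n ⊕ GTNode n × GTNode n → GTNode n → ℤ
  | Sum.inl p => Pi.single p 1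
  | Sum.inr (p, q) => Pi.single p 1 - Pi.single q 1

/-- The right-hand sides for the forms `gtForm`. -/
def gtBound (wt : Fin n → ℤ) : GTNode n ⊕ GTNode n × GTNode n → ℝ
  | Sum.inl p => (wt p.col : ℝ)
  | Sum.inr _ => 0

open scoped Classical in
/-- The labels of the equations, which prescribe row 0. -/
noncomputable def gtEquations (n : ℕ) : Finset (GTNode n ⊕ GTNode n × GTNode n) :=
  {k | ∃ p : GTNode n, p.row = 0 ∧ k = Sum.inl p}

open scoped Classical in
/-- The labels of the Gelfand-Tsetlin inequalities that are tight at `v`. All of the inequalities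
are tight at `v = 0`. -/
noncomputable def gtInequalities (v : GTSpace n) : Finset (GTNode n ⊕ GTNode n × GTNode n) :=
  {k | ∃ p q : GTNode n, p.Dominates q ∧ v p = v q ∧ k = Sum.inr (p, q)}

@[simp]
theorem intForm_gtForm_inl (p : GTNode n) (x : GTSpace n) :
    intForm (gtForm (Sum.inl p)) x = x p := by
  classical
  simp [intForm_apply, gtForm, Pi.single_apply]

@[simp]
theorem intForm_gtForm_inr (p q : GTNode n) (x : GTSpace n) :
    intForm (gtForm (Sum.inr (p, q))) x = x p - x q := by
  classical
  simp [intForm_apply, gtForm, Pi.single_apply, sub_mul, Finset.sum_sub_distrib]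

theorem forall_mem_gtEquations {P : GTNode n ⊕ GTNode n × GTNode n → Prop} :
    (∀ k ∈ gtEquations n, P k) ↔ ∀ p : GTNode n, p.row = 0 → P (Sum.inl p) := by
  simp only [gtEquations, Finset.mem_filter, Finset.mem_univ, true_and]
  exact ⟨fun h p hp => h _ ⟨p, hp, rfl⟩, by rintro h _ ⟨p, hp, rfl⟩; exact h p hp⟩

theorem forall_mem_gtInequalities {v : GTSpace n}
    {P : GTNode n ⊕ GTNode n × GTNode n → Prop} :
    (∀ k ∈ gtInequalities v, P k) ↔
      ∀ p q : GTNode n, p.Dominates q → v p = v q → P (Sum.inr (p, q)) := by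
  simp only [gtInequalities, Finset.mem_filter, Finset.mem_univ, true_and]
  exact ⟨fun h p q hpq he => h _ ⟨p, q, hpq, he, rfl⟩,
    by rintro h _ ⟨p, q, hpq, he, rfl⟩; exact h p q hpq he⟩

/-- The part of the Gelfand-Tsetlin system of the weight `wt` with the inequalities that are tight
at `v`. -/
theorem mem_systemSet_gt {wt : Fin n → ℤ} {v x : GTSpace n} :
    x ∈ systemSet gtForm (gtBound wt) (gtEquations n) (gtInequalities v) ↔
      (∀ p : GTNode n, p.row = 0 → x p = (wt p.col : ℝ)) ∧
        ∀ p q : GTNode n, p.Dominates q → v p = v q → x q ≤ x p := by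
  simp only [systemSet, Set.mem_ofPred_eq, forall_mem_gtEquations, forall_mem_gtInequalities,
    intForm_gtForm_inl, intForm_gtForm_inr, gtBound, sub_nonneg]

theorem mem_systemSet_gt_zero {v d : GTSpace n} :
    d ∈ systemSet gtForm 0 (gtEquations n) (gtInequalities v) ↔
      (∀ p : GTNode n, p.row = 0 → d p = 0) ∧
        ∀ p q : GTNode n, p.Dominates q → v p = v q → d q ≤ d p := by
  simp only [systemSet, Set.mem_ofPred_eq, forall_mem_gtEquations, forall_mem_gtInequalities,
    intForm_gtForm_inl, intForm_gtForm_inr, Pi.zero_apply, sub_nonneg]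

theorem mem_systemCone_gt {wt : Fin n → ℤ} {v u d : GTSpace n} :
    d ∈ systemCone gtForm (gtBound wt) (gtEquations n) (gtInequalities v) u ↔
      u ∈ systemSet gtForm (gtBound wt) (gtEquations n) (gtInequalities v) ∧
        (∀ p : GTNode n, p.row = 0 → d p = 0) ∧
        ∀ p q : GTNode n, p.Dominates q → v p = v q → u p = u q → d q ≤ d p := by
  simp only [mem_systemCone, forall_mem_gtEquations, forall_mem_gtInequalities,
    intForm_gtForm_inl, intForm_gtForm_inr, gtBound, sub_nonneg, sub_eq_zero]

theorem gtPolytope_eq_systemSet (wt : Fin n → ℤ) :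
    GTPolytope wt = systemSet gtForm (gtBound wt) (gtEquations n) (gtInequalities 0) := by
  ext x
  simp [mem_systemSet_gt, GTPolytope]

theorem mem_convexTangentCone_iff {ι : Type*} {P : Set (ι → ℝ)} {v y : ι → ℝ} (hv : v ∈ P) :
    y ∈ convexTangentCone P v ↔ ∃ ε : ℝ, 0 < ε ∧ v + ε • (y - v) ∈ P := by
  constructor
  · rintro ⟨x, hx, t, ht, rfl⟩
    rcases ht.eq_or_lt with rfl | ht
    · exact ⟨1, one_pos, by simpa using hv⟩
    · exact ⟨t⁻¹, inv_pos.2 ht, by simpa [smul_smul, ht.ne'] using hx⟩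
  · rintro ⟨ε, hε, h⟩
    exact ⟨_, h, ε⁻¹, (inv_pos.2 hε).le, by simp [smul_smul, hε.ne']⟩

theorem GTVertex.mem_cone_iff {wt : Fin n → ℤ} (u : GTVertex wt) (y : GTSpace n) :
    y ∈ u.cone ↔
      y - u.1 ∈ systemCone gtForm (gtBound wt) (gtEquations n) (gtInequalities 0) u.1 := by
  rw [mem_systemCone_iff_exists, ← gtPolytope_eq_systemSet, and_iff_right u.2.1, GTVertex.cone,
    mem_convexTangentCone_iff u.2.1]

/-- The tangent cone of a vertex of the polytope of `wt`, moved to the origin, is the recession cone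
of the system of inequalities tight at the vertex. -/
theorem GTVertex.systemCone_self {wt : Fin n → ℤ} (v : GTVertex wt) :
    systemCone gtForm (gtBound wt) (gtEquations n) (gtInequalities 0) v.1 =
      systemSet gtForm 0 (gtEquations n) (gtInequalities v.1) := by
  ext d
  rw [mem_systemCone_gt, ← gtPolytope_eq_systemSet, and_iff_right v.2.1, mem_systemSet_gt_zero]
  simp

/-- At each node, a vertex `u` and its image under the degeneration are entries of the two weights
with a common index. -/
theorem GTVertex.exists_eq_of_degenerate_eq {wt reg : Fin n → ℤ} {hwt : Antitone wt}
    {hreg : StrictAnti reg} {u : GTVertex reg} {v : GTVertex wt} (h : u.degenerate hwt hreg = v)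
    (p : GTNode n) : ∃ j : Fin n, u.1 p = (reg j : ℝ) ∧ v.1 p = (wt j : ℝ) := by
  obtain ⟨j, hj⟩ := u.exists_eq p
  refine ⟨j, hj, ?_⟩
  rw [← h]
  exact u.substitute_eq wt hreg p j hj

/-- Every inequality tight at a vertex `u` in the fiber over `v` is tight at `v`, so that omitting
the inequalities that are not tight at `v` does not change the tangent cone at `u`. -/
theorem GTVertex.systemCone_of_degenerate_eq {wt reg : Fin n → ℤ} {hwt : Antitone wt}
    {hreg : StrictAnti reg} {u : GTVertex reg} {v : GTVertex wt}
    (h : u.degenerate hwt hreg = v) :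
    systemCone gtForm (gtBound reg) (gtEquations n) (gtInequalities 0) u.1 =
      systemCone gtForm (gtBound reg) (gtEquations n) (gtInequalities v.1) u.1 := by
  have htight : ∀ p q : GTNode n, u.1 p = u.1 q → v.1 p = v.1 q := by
    intro p q hpq
    obtain ⟨j, hj, hj'⟩ := exists_eq_of_degenerate_eq h p
    obtain ⟨k, hk, hk'⟩ := exists_eq_of_degenerate_eq h q
    rw [hj, hk, Int.cast_inj] at hpq
    rw [hj', hk', hreg.injective hpq]
  have hmem : u.1 ∈ systemSet gtForm (gtBound reg) (gtEquations n) (gtInequalities v.1) :=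
    mem_systemSet_gt.2 ⟨u.2.1.1, fun p q hpq _ => u.2.1.2 p q hpq⟩
  ext d
  rw [mem_systemCone_gt, mem_systemCone_gt, ← gtPolytope_eq_systemSet, and_iff_right u.2.1,
    and_iff_right hmem]
  refine and_congr_right fun _ => ⟨fun hd p q hpq _ he => hd p q hpq rfl he,
    fun hd p q hpq _ he => hd p q hpq (htight p q he) he⟩

/-- A point of the polyhedron cut out by the inequalities tight at `v` whose tangent cone has no
line is a vertex of the polytope of `reg` in the fiber over `v`. -/
theorem GTVertex.exists_degenerate_eq {wt reg : Fin n → ℤ} (hwt : Antitone wt)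
    (hreg : StrictAnti reg) (v : GTVertex wt) {u : GTSpace n}
    (hu : u ∈ systemSet gtForm (gtBound reg) (gtEquations n) (gtInequalities v.1))
    (hline : ∀ d : GTSpace n, (∀ p : GTNode n, p.row = 0 → d p = 0) →
      (∀ p q : GTNode n, p.Dominates q → v.1 p = v.1 q → u p = u q → d p = d q) → d = 0) :
    ∃ u' : GTVertex reg, u'.degenerate hwt hreg = v ∧ u'.1 = u := by
  classical
  rw [mem_systemSet_gt] at hu
  -- Otherwise the set of nodes where `(u, v)` takes the same value as at `p` can be moved freely.
  have hidx : ∀ p : GTNode n, ∃ j : Fin n, u p = (reg j : ℝ) ∧ v.1 p = (wt j : ℝ) := by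
    intro p
    by_contra! hne
    have h := hline (fun q => if u q = u p ∧ v.1 q = v.1 p then 1 else 0)
      (fun q hq => if_neg fun he => hne q.col (by rw [← he.1, hu.1 q hq])
        (by rw [← he.2, v.2.1.1 q hq]))
      (fun q r _ h1 h2 => by simp [h1, h2])
    simpa using congrFun h p
  have hmem : u ∈ GTPolytope reg := by
    refine ⟨hu.1, fun p q hpq => ?_⟩
    by_cases he : v.1 p = v.1 q
    · exact hu.2 p q hpq he
    · obtain ⟨j, hj, hj'⟩ := hidx p
      obtain ⟨k, hk, hk'⟩ := hidx q
      have hlt : v.1 q < v.1 p := lt_of_le_of_ne (v.2.1.2 p q hpq) (Ne.symm he)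
      rw [hj', hk', Int.cast_lt] at hlt
      rw [hj, hk, Int.cast_le]
      exact (hreg (hwt.reflect_lt hlt)).le
  have hext : u ∈ (GTPolytope reg).extremePoints ℝ := by
    rw [mem_extremePoints]
    refine ⟨hmem, fun y hy z hz hseg => ?_⟩
    obtain ⟨s, t, hs, ht, hst, rfl⟩ := hseg
    have hyz : y - z = 0 := by
      refine hline _ (fun p hp => ?_) fun p q hpq _ he => ?_
      · simp [hy.1 p hp, hz.1 p hp]
      · simp only [Pi.add_apply, Pi.smul_apply, smul_eq_mul] at he
        have h1 := hy.2 p q hpq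
        have h2 := hz.2 p q hpq
        have h3 : 0 ≤ s * (y p - y q) := mul_nonneg hs.le (by linarith)
        have h4 : 0 ≤ t * (z p - z q) := mul_nonneg ht.le (by linarith)
        have h5 : s * (y p - y q) = 0 := by linarith
        have h6 : t * (z p - z q) = 0 := by linarith
        have h7 := (mul_eq_zero.1 h5).resolve_left hs.ne'
        have h8 := (mul_eq_zero.1 h6).resolve_left ht.ne'
        simp only [Pi.sub_apply]
        linarith
    obtain rfl : y = z := sub_eq_zero.1 hyz
    rw [← add_smul, hst, one_smul]
    exact ⟨rfl, rfl⟩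
  refine ⟨⟨u, hext⟩, Subtype.ext (funext fun p => ?_), rfl⟩
  obtain ⟨j, hj, hj'⟩ := hidx p
  rw [hj']
  exact GTVertex.substitute_eq wt hreg ⟨u, hext⟩ p j hj

theorem systemSet_gt_nonempty {reg : Fin n → ℤ} (hreg : Antitone reg) (v : GTSpace n) :
    (systemSet gtForm (gtBound reg) (gtEquations n) (gtInequalities v)).Nonempty := by
  -- A point whose coordinates depend only on the column.
  refine ⟨fun p => (reg p.col : ℝ), mem_systemSet_gt.2 ⟨fun p _ => rfl, fun p q hpq _ => ?_⟩⟩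
  have hcol : p.col ≤ q.col := by
    rw [Fin.le_def]
    rcases hpq with h | h
    · exact h.2.ge
    · omega
  exact_mod_cast hreg hcol

end GelfandTsetlin

theorem mainTheorem9 {n : ℕ} (wt reg : Fin n → ℤ) (hwt : Antitone wt) (hreg : StrictAnti reg)
    (v : GTVertex wt) :
    EqModLines (charFunction v.cone)
      (∑ u ∈ v.fiber hwt hreg, charFunction ((fun x => x + (v.1 - u.1)) '' u.cone)) := by
  classical
  choose j hj using v.exists_eq
  let w : GTNode n → ℤ := fun p => wt (j p)
  have hw : v.1 = fun p => (w p : ℝ) := funext hj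
  have hleft : charFunction v.cone =
      latticeShift w (charFunction (systemSet gtForm 0 (gtEquations n) (gtInequalities v.1))) := by
    rw [latticeShift_charFunction, ← v.systemCone_self]
    congr 1
    ext y
    rw [v.mem_cone_iff, Set.mem_ofPred_eq]
    congr! 1
    rw [hw]
    rfl
  have hright : ∀ u ∈ v.fiber hwt hreg, charFunction ((fun x => x + (v.1 - u.1)) '' u.cone) =
      latticeShift w (charFunction
        (systemCone gtForm (gtBound reg) (gtEquations n) (gtInequalities v.1) u.1)) := by
    intro u hu
    rw [GTVertex.mem_fiber] at hu
    rw [latticeShift_charFunction, ← GTVertex.systemCone_of_degenerate_eq hu]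
    congr 1
    ext y
    have hy : (fun p => y p - (w p : ℝ)) = y - v.1 := by rw [hw]; rfl
    rw [Set.image_add_right, Set.mem_preimage, u.mem_cone_iff, Set.mem_ofPred_eq, hy]
    congr! 1
    abel
  have hmem : ∀ u : GTVertex reg,
      latticeShift w (charFunction
        (systemCone gtForm (gtBound reg) (gtEquations n) (gtInequalities v.1) u.1)) ∈
      polyhedralSpan (GTNode n) := by
    intro u
    rw [systemCone_eq_systemSet
      (mem_systemSet_gt.2 ⟨u.2.1.1, fun p q hpq _ => u.2.1.2 p q hpq⟩)]
    exact latticeShift_mem_polyhedralSpan _ _ _ _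
  rw [Finset.sum_congr rfl hright, hleft]
  refine ⟨latticeShift_mem_polyhedralSpan _ _ _ _, Submodule.sum_mem _ fun u _ => hmem u, ?_⟩
  let V : Finset (GTSpace n) := (v.fiber hwt hreg).map (Function.Embedding.subtype _)
  obtain ⟨F, hF, hVF⟩ := ((coneRelation_of_nonempty w _ _ _ _
    (systemSet_gt_nonempty hreg.antitone v.1)).and (eventually_ge_atTop V)).exists
  rw [← Finset.sum_sdiff hVF] at hF
  have hrest : ∑ u ∈ F \ V, charFunction
      (systemCone gtForm (gtBound reg) (gtEquations n) (gtInequalities v.1) u) ∈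
      shiftedLineSpan w := by
    refine Submodule.sum_mem _ fun u hu => charFunction_systemCone_mem w fun huQ => ?_
    by_contra! hline
    obtain ⟨u', hu', rfl⟩ := v.exists_degenerate_eq hwt hreg huQ fun d h0 hd => by
      by_contra hne
      obtain ⟨k, hk, hku, hk'⟩ := hline d hne
        (forall_mem_gtEquations.2 fun p hp => by simp [h0 p hp])
      refine hk' (forall_mem_gtInequalities
        (P := fun k => intForm (gtForm k) u = gtBound reg k → intForm (gtForm k) d = 0) |>.2
        (fun p q hpq hv he => ?_) k hk hku)
      simp only [intForm_gtForm_inr, gtBound, sub_eq_zero] at he ⊢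
      exact hd p q hpq hv he
    exact (Finset.mem_sdiff.1 hu).2
      (Finset.mem_map_of_mem _ ((GTVertex.mem_fiber hwt hreg v u').2 hu'))
  have h := Submodule.add_mem _ hF hrest
  rw [sub_add_eq_sub_sub_swap, sub_add_cancel, Finset.sum_map] at h
  rw [← map_sum, ← map_sub]
  exact h
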